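/- Let $\mathcal T$ be an essentially small tensor triangulated category: an essentially small triangulated category with a symmetric monoidal structure $(\otimes,\mathbf 1)$ that is exact in each variable, i.e. there are isomorphisms $X\otimes Y[n]\cong (X\otimes Y)[n]$, natural in both $X$ and $Y$, with respect to which each functor $X\otimes-$ (and hence, by symmetry, each $-\otimes X$) preserves exact triangles. Its spectrum $\operatorname{Spc}\mathcal T$ is the set of prime thick $\otimes$-ideals of $\mathcal T$, i.e. proper full triangulated subcategories $\mathcal P$ that are closed under direct summands and under tensoring with arbitrary objects, and such that $X\otimes Y\in\mathcal P$ implies $X\in\mathcal P$ or $Y\in\mathcal P$. It carries the topology with the sets $\{\mathcal P\mid X\in\mathcal P\}$, $X\in\mathcal T$, as a basis of open sets. Call $\mathcal T$ *local* if $\operatorname{Spc}\mathcal T$ has a unique closed point. An object $X$ is *invertible* if $X\otimes Y\cong\mathbf 1$ for some object $Y$. A *graded commutative 2-ring* is an essentially small $\mathbb Z$-linear category with a biadditive symmetric monoidal structure in which every object is invertible. A *homogeneous ideal* $\mathcal I$ of it is a family of subgroups $\mathcal I(g,h)\subseteq\operatorname{Hom}(g,h)$, for all objects $g,h$, that is closed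 under composition and under tensor product, on either side, with arbitrary morphisms. It is *proper* if it does not contain all morphisms, and *maximal* if it is maximal under inclusion among the proper homogeneous ideals. A *central 2-ring* of $\mathcal T$ is a full tensor subcategory (containing $\mathbf 1$ and closed under $\otimes$) that consists of invertible objects and is closed under taking duals. **Theorem.** If $\mathcal T$ is local, then every central 2-ring $\mathcal R$ of $\mathcal T$ is a local graded commutative 2-ring, that is, $\mathcal R$ is a graded commutative 2-ring and it has exactly one maximal homogeneous ideal. Moreover, this maximal ideal consists precisely of the non-invertible morphisms of $\mathcal R$. -/

import Mathlib

open CategoryTheory MonoidalCategory Limits Pretriangulated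

universe w v u

/-! ### Invertible objects and graded commutative 2-rings -/

section TwoRings

/-- An object `X` of a monoidal category is invertible if `X ⊗ Y ≅ 𝟙` for some `Y`. -/
def IsTensorInvertible {C : Type u} [Category.{v} C] [MonoidalCategory C] (X : C) : Prop :=
  ∃ Y : C, Nonempty (X ⊗ Y ≅ 𝟙_ C)

/-- A graded commutative 2-ring (graded by its own Picard 2-group): an essentially small
`ℤ`-linear category with a biadditive symmetric monoidal structure for which every object is
invertible. -/
class IsGradedCommTwoRing (C : Type u) [Category.{v} C] [Preadditive C] [MonoidalCategory C]
    [SymmetricCategory C] : Prop extends MonoidalPreadditive C where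
  essentiallySmall : EssentiallySmall.{w} C
  invertible (X : C) : IsTensorInvertible X

/-- A homogeneous ideal: subgroups `hom X Y` of the groups of morphisms `X ⟶ Y`, closed under
composing and under tensoring, on both sides, with arbitrary morphisms. -/
@[ext]
structure HomogeneousTwoIdeal (C : Type u) [Category.{v} C] [Preadditive C]
    [MonoidalCategory C] where
  hom (X Y : C) : AddSubgroup (X ⟶ Y)
  comp_mem {X' X Y Y' : C} (f : X' ⟶ X) (r : X ⟶ Y) (g : Y ⟶ Y') :
    r ∈ hom X Y → f ≫ r ≫ g ∈ hom X' Y'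
  tensor_left_mem {X Y X' Y' : C} (s : X' ⟶ Y') (r : X ⟶ Y) :
    r ∈ hom X Y → (s ⊗ₘ r) ∈ hom (X' ⊗ X) (Y' ⊗ Y)
  tensor_right_mem {X Y X' Y' : C} (r : X ⟶ Y) (s : X' ⟶ Y') :
    r ∈ hom X Y → (r ⊗ₘ s) ∈ hom (X ⊗ X') (Y ⊗ Y')

namespace HomogeneousTwoIdeal

variable {C : Type u} [Category.{v} C] [Preadditive C] [MonoidalCategory C]

/-- Homogeneous ideals are ordered by inclusion. -/
instance : PartialOrder (HomogeneousTwoIdeal C) :=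
  PartialOrder.lift HomogeneousTwoIdeal.hom (fun _ _ h => HomogeneousTwoIdeal.ext h)

/-- A homogeneous ideal is proper if some morphism does not belong to it. -/
def IsProper (I : HomogeneousTwoIdeal C) : Prop :=
  ∃ (X Y : C) (r : X ⟶ Y), r ∉ I.hom X Y

/-- A maximal homogeneous ideal: maximal with respect to inclusion among the proper ones. -/
def IsMaximal (I : HomogeneousTwoIdeal C) : Prop :=
  Maximal IsProper I

end HomogeneousTwoIdeal

end TwoRings

/-! ### Tensor triangulated categories -/

section TensorTriangulated

variable (T : Type u) [Category.{v} T] [HasZeroObject T] [HasShift T ℤ] [Preadditive T]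
  [∀ n : ℤ, (shiftFunctor T n).Additive] [Pretriangulated T]
  [MonoidalCategory T] [SymmetricCategory T]

/-- The tensor product of a triangulated, symmetric monoidal category is exact in each variable:
every `X ⊗ -` is an exact functor with respect to isomorphisms
`X ⊗ Y⟦n⟧ ≅ (X ⊗ Y)⟦n⟧` that are natural in both variables `X` and `Y`. (Exactness of
`- ⊗ X` follows by the symmetry.) -/
class TensorTriangulated where
  commShift (X : T) : (tensorLeft X).CommShift ℤ
  isTriangulated (X : T) : (tensorLeft X).IsTriangulated
  commShift_natural {X X' : T} (f : X ⟶ X') :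
    NatTrans.CommShift (F₁ := tensorLeft X) (F₂ := tensorLeft X') ((curriedTensor T).map f) ℤ

variable {T}

/-- A thick tensor ideal: a full triangulated subcategory closed under direct summands and under
tensoring with arbitrary objects. -/
structure IsThickTensorIdeal (P : ObjectProperty T) : Prop where
  isTriangulated : P.IsTriangulated
  isStableUnderRetracts : P.IsStableUnderRetracts
  tensor_mem (X Y : T) : P Y → P (X ⊗ Y)

variable (T) in
/-- The underlying set of the spectrum `Spc T`: the proper thick tensor ideals `P` such that
`X ⊗ Y ∈ P` implies `X ∈ P` or `Y ∈ P`. -/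
structure TriangularSpectrum where
  prime : ObjectProperty T
  isThickTensorIdeal : IsThickTensorIdeal prime
  proper : ∃ X : T, ¬ prime X
  mem_or_mem (X Y : T) : prime (X ⊗ Y) → prime X ∨ prime Y

/-- The topology of `Spc T`, generated by the sets `U(X) = {P | X ∈ P}`, that is, by the
complements of the supports `supp X = {P | X ∉ P}`. -/
instance : TopologicalSpace (TriangularSpectrum T) :=
  TopologicalSpace.generateFrom (Set.range fun X : T => {P : TriangularSpectrum T | P.prime X})

variable (T) in
/-- `T` is local if its spectrum has a unique closed point. -/
def IsLocalTensorTriangulated : Prop :=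
  ∃! P : TriangularSpectrum T, IsClosed ({P} : Set (TriangularSpectrum T))

/-- A central 2-ring of `T`: a full tensor subcategory (given by its objects) that consists of
invertible objects and contains a dual of each of its objects. -/
class IsCentralTwoRing (R : ObjectProperty T) : Prop extends R.IsMonoidal where
  invertible (X : T) : R X → IsTensorInvertible X
  dual_mem (X : T) : R X → ∃ Y : T, R Y ∧ Nonempty (ExactPairing X Y)

end TensorTriangulated

/-! Everything reduces to locality of `End(𝟙)`. Scalars identify `End(𝟙)` with `End(X)` for `X`
invertible, so in a graded commutative 2-ring a factor of an isomorphism, for `≫` or `⊗`, is an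
isomorphism. Non-invertible morphisms thus form an ideal once `r + s = 1` in `End(𝟙)` forces `r` or
`s` to be invertible.

For that, let `C`, `D` be the cones of `r`, `s`. Since `s²` kills `D`, `r = 1 - s` is invertible on
`D`, whence `D ⊗ C = 0` (`isZero_tensor_of_add_eq_id`). Minimal primes are closed points, so
locality gives a least prime, and `C` or `D` lies in every prime. Such a cone is zero: any thick
ideal containing `C ⊗ C` contains `C` (`mem_of_tensor_self_mem`), so Zorn's lemma gives a prime
avoiding `C ≠ 0`. Hence `r` or `s` is invertible. -/

/-! ### The action of `End(𝟙)` on objects. -/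

section Scalars

variable {C : Type u} [Category.{v} C] [MonoidalCategory C]

/-- The action of an endomorphism of the unit object on an object `X`. -/
def scalar (r : 𝟙_ C ⟶ 𝟙_ C) (X : C) : X ⟶ X :=
  (λ_ X).inv ≫ r ▷ X ≫ (λ_ X).hom

lemma scalar_naturality (r : 𝟙_ C ⟶ 𝟙_ C) {X Y : C} (f : X ⟶ Y) :
    scalar r X ≫ f = f ≫ scalar r Y := by
  rw [scalar, scalar, Category.assoc, Category.assoc, ← leftUnitor_naturality,
    ← whisker_exchange_assoc, leftUnitor_inv_naturality_assoc]

lemma scalar_unit (r : 𝟙_ C ⟶ 𝟙_ C) : scalar r (𝟙_ C) = r := by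
  rw [scalar, unitors_equal, rightUnitor_naturality, unitors_inv_equal, Iso.inv_hom_id_assoc]

lemma scalar_id (X : C) : scalar (𝟙 (𝟙_ C)) X = 𝟙 X := by
  simp [scalar]

lemma scalar_add [Preadditive C] [MonoidalPreadditive C] (r s : 𝟙_ C ⟶ 𝟙_ C) (X : C) :
    scalar (r + s) X = scalar r X + scalar s X := by
  simp [scalar]

lemma isIso_scalar (r : 𝟙_ C ⟶ 𝟙_ C) [IsIso r] (X : C) : IsIso (scalar r X) := by
  unfold scalar; infer_instance

lemma scalar_eq_whiskerLeft [BraidedCategory C] (r : 𝟙_ C ⟶ 𝟙_ C) (X : C) :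
    scalar r X = (ρ_ X).inv ≫ X ◁ r ≫ (ρ_ X).hom := by
  rw [scalar, ← leftUnitor_inv_braiding, Category.assoc, ← BraidedCategory.braiding_naturality_left_assoc,
    braiding_rightUnitor]

end Scalars

/-! ### Invertible objects. -/

section Invertible

variable {C : Type u} [Category.{v} C] [MonoidalCategory C] [SymmetricCategory C]

/-- Tensoring with an invertible object is an equivalence. -/
lemma IsTensorInvertible.isEquivalence_tensorLeft {X : C} (hX : IsTensorInvertible X) :
    (tensorLeft X).IsEquivalence := by
  obtain ⟨Y, ⟨e⟩⟩ := hX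
  exact (CategoryTheory.Equivalence.mk (tensorLeft X) (tensorLeft Y)
    ((leftUnitorNatIso C).symm ≪≫ (curriedTensor C).mapIso (e.symm ≪≫ β_ X Y) ≪≫
      tensorLeftTensor Y X)
    ((tensorLeftTensor X Y).symm ≪≫ (curriedTensor C).mapIso e ≪≫
      leftUnitorNatIso C)).isEquivalence_functor

lemma IsTensorInvertible.scalar_injective {X : C} (hX : IsTensorInvertible X)
    {r s : 𝟙_ C ⟶ 𝟙_ C} (h : scalar r X = scalar s X) : r = s := by
  have := hX.isEquivalence_tensorLeft
  apply (tensorLeft X).map_injective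
  simpa [scalar_eq_whiskerLeft] using h

lemma IsTensorInvertible.exists_scalar_eq {X : C} (hX : IsTensorInvertible X) (f : X ⟶ X) :
    ∃ r : 𝟙_ C ⟶ 𝟙_ C, scalar r X = f := by
  have := hX.isEquivalence_tensorLeft
  obtain ⟨r, hr⟩ := (tensorLeft X).map_surjective ((ρ_ X).hom ≫ f ≫ (ρ_ X).inv)
  refine ⟨r, ?_⟩
  have hr' : X ◁ r = (ρ_ X).hom ≫ f ≫ (ρ_ X).inv := hr
  simp [scalar_eq_whiskerLeft, hr']

/-- A split epimorphism between invertible objects is an isomorphism. -/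
lemma IsTensorInvertible.isIso_of_section {X Y : C} (hX : IsTensorInvertible X)
    (hY : IsTensorInvertible Y) (f : X ⟶ Y) (i : Y ⟶ X) (h : i ≫ f = 𝟙 Y) : IsIso f := by
  -- The idempotent `f ≫ i` is a scalar `r` on `X`; as `r` acts as the identity on the retract `Y`,
  -- `r = 1`.
  obtain ⟨r, hr⟩ := hX.exists_scalar_eq (f ≫ i)
  have h1 : r = 𝟙 _ := by
    apply hY.scalar_injective
    calc scalar r Y = i ≫ f ≫ scalar r Y := by rw [reassoc_of% h]
      _ = scalar (𝟙 _) Y := by simp [← scalar_naturality, hr, h, scalar_id]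
  exact ⟨i, by rw [← hr, h1, scalar_id], h⟩

/-- A dual of an invertible object is an inverse. -/
lemma IsTensorInvertible.nonempty_iso_of_exactPairing {X Y : C} (hX : IsTensorInvertible X)
    [ExactPairing X Y] : Nonempty (X ⊗ Y ≅ 𝟙_ C) := by
  have := hX.isEquivalence_tensorLeft
  exact ⟨β_ X Y ≪≫ whiskerLeftIso Y (ρ_ X).symm ≪≫
    asIso ((tensorLeftAdjunction X Y).counit.app (𝟙_ C))⟩

end Invertible

/-! ### The ideal of non-invertible morphisms. -/

section GradedTwoRing

variable {C : Type u} [Category.{v} C] [Preadditive C] [MonoidalCategory C]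
  [SymmetricCategory C]

namespace IsGradedCommTwoRing

/-- `g` is split by `inv (f ≫ g) ≫ f`, and split epimorphisms between invertible objects are
isomorphisms. -/
lemma isIso_of_isIso_comp_left [IsGradedCommTwoRing.{w} C] {X Y Z : C} (f : X ⟶ Y) (g : Y ⟶ Z)
    [IsIso (f ≫ g)] : IsIso f := by
  have : IsIso g := (invertible.{w} Y).isIso_of_section (invertible.{w} Z) g (inv (f ≫ g) ≫ f)
    (by simp)
  exact IsIso.of_isIso_comp_right f g

lemma isIso_of_isIso_comp_right [IsGradedCommTwoRing.{w} C] {X Y Z : C} (f : X ⟶ Y) (g : Y ⟶ Z)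
    [IsIso (f ≫ g)] : IsIso g :=
  have := isIso_of_isIso_comp_left.{w} f g
  IsIso.of_isIso_comp_left f g

lemma isIso_of_isIso_whiskerLeft [IsGradedCommTwoRing.{w} C] (Z : C) {X Y : C} (f : X ⟶ Y)
    [IsIso (Z ◁ f)] : IsIso f := by
  have := (invertible.{w} Z).isEquivalence_tensorLeft
  have : IsIso ((tensorLeft Z).map f) := by assumption
  exact isIso_of_reflects_iso f (tensorLeft Z)

lemma isIso_of_isIso_tensorHom_left [IsGradedCommTwoRing.{w} C] {X Y X' Y' : C} (f : X ⟶ Y)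
    (g : X' ⟶ Y') [IsIso (f ⊗ₘ g)] : IsIso g := by
  have : IsIso (f ▷ X' ≫ Y ◁ g) := by rw [← MonoidalCategory.tensorHom_def]; infer_instance
  have := isIso_of_isIso_comp_right.{w} (f ▷ X') (Y ◁ g)
  exact isIso_of_isIso_whiskerLeft.{w} Y g

lemma isIso_of_isIso_tensorHom_right [IsGradedCommTwoRing.{w} C] {X Y X' Y' : C} (f : X ⟶ Y)
    (g : X' ⟶ Y') [IsIso (f ⊗ₘ g)] : IsIso f := by
  have : IsIso (g ⊗ₘ f) := by
    have h : g ⊗ₘ f = (β_ X' X).hom ≫ (f ⊗ₘ g) ≫ (β_ Y Y').hom := by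
      simp
    rw [h]; infer_instance
  exact isIso_of_isIso_tensorHom_left.{w} g f

/-- If the sum of two morphisms is invertible then so is one of them, provided that this holds
for endomorphisms of the unit. -/
lemma isIso_or_isIso_of_isIso_add [IsGradedCommTwoRing.{w} C]
    (hC : ∀ a b : 𝟙_ C ⟶ 𝟙_ C, a + b = 𝟙 _ → IsIso a ∨ IsIso b) {X Y : C} (f g : X ⟶ Y)
    [IsIso (f + g)] : IsIso f ∨ IsIso g := by
  have := IsGradedCommTwoRing.toMonoidalPreadditive.{w} (C := C)
  obtain ⟨a, ha⟩ := (invertible.{w} X).exists_scalar_eq (f ≫ inv (f + g))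
  obtain ⟨b, hb⟩ := (invertible.{w} X).exists_scalar_eq (g ≫ inv (f + g))
  have hab : a + b = 𝟙 _ := by
    apply (invertible.{w} X).scalar_injective
    rw [scalar_add, ha, hb, ← Preadditive.add_comp, scalar_id, IsIso.hom_inv_id]
  refine (hC a b hab).imp (fun (_ : IsIso a) => ?_) (fun (_ : IsIso b) => ?_)
  · have := isIso_scalar a X
    rw [ha] at this
    exact isIso_of_isIso_comp_left.{w} f (inv (f + g))
  · have := isIso_scalar b X
    rw [hb] at this
    exact isIso_of_isIso_comp_left.{w} g (inv (f + g))

end IsGradedCommTwoRing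

/-- A homogeneous ideal of a graded commutative 2-ring that contains an isomorphism contains
every morphism. -/
lemma HomogeneousTwoIdeal.mem_of_isIso [IsGradedCommTwoRing.{w} C] (I : HomogeneousTwoIdeal C)
    {X Y : C} (r : X ⟶ Y) [IsIso r] (hr : r ∈ I.hom X Y) {X' Y' : C} (f : X' ⟶ Y') :
    f ∈ I.hom X' Y' := by
  -- Cancelling `r` and tensoring with an inverse of `X` puts `𝟙 (𝟙_ C)` in the ideal.
  obtain ⟨Z, ⟨e⟩⟩ := IsGradedCommTwoRing.invertible.{w} X
  have h1 : 𝟙 (𝟙_ C) ∈ I.hom _ _ := by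
    have h := I.comp_mem e.inv _ (inv r ▷ Z ≫ e.hom) (I.tensor_right_mem r (𝟙 Z) hr)
    convert h using 1
    simp [← comp_whiskerRight_assoc]
  have h := I.comp_mem (λ_ X').inv _ (λ_ Y').hom (I.tensor_right_mem _ f h1)
  convert h using 1
  simp

/-- The homogeneous ideal of non-invertible morphisms. -/
def nonIsoTwoIdeal [IsGradedCommTwoRing.{w} C]
    (h0 : ∀ X Y : C, ¬ IsIso (0 : X ⟶ Y))
    (hC : ∀ a b : 𝟙_ C ⟶ 𝟙_ C, a + b = 𝟙 _ → IsIso a ∨ IsIso b) : HomogeneousTwoIdeal C where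
  hom X Y :=
    { carrier := {r | ¬ IsIso r}
      zero_mem' := h0 X Y
      add_mem' := fun ha hb (_ : IsIso _) =>
        (IsGradedCommTwoRing.isIso_or_isIso_of_isIso_add.{w} hC _ _).elim ha hb
      neg_mem' := fun {r} hr (_ : IsIso (-r)) =>
        hr ⟨-inv (-r), by rw [Preadditive.comp_neg, ← Preadditive.neg_comp, IsIso.hom_inv_id],
        by rw [Preadditive.neg_comp, ← Preadditive.comp_neg, IsIso.inv_hom_id]⟩ }
  comp_mem f r g hr (_ : IsIso (f ≫ r ≫ g)) := hr
    (have := IsGradedCommTwoRing.isIso_of_isIso_comp_right.{w} f (r ≫ g)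
     IsGradedCommTwoRing.isIso_of_isIso_comp_left.{w} r g)
  tensor_left_mem s r hr (_ : IsIso (s ⊗ₘ r)) :=
    hr (IsGradedCommTwoRing.isIso_of_isIso_tensorHom_left.{w} s r)
  tensor_right_mem r s hr (_ : IsIso (r ⊗ₘ s)) :=
    hr (IsGradedCommTwoRing.isIso_of_isIso_tensorHom_right.{w} r s)

lemma mem_nonIsoTwoIdeal [IsGradedCommTwoRing.{w} C]
    (h0 : ∀ X Y : C, ¬ IsIso (0 : X ⟶ Y))
    (hC : ∀ a b : 𝟙_ C ⟶ 𝟙_ C, a + b = 𝟙 _ → IsIso a ∨ IsIso b) {X Y : C} (r : X ⟶ Y) :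
    r ∈ (nonIsoTwoIdeal.{w} h0 hC).hom X Y ↔ ¬ IsIso r :=
  Iff.rfl

lemma isProper_nonIsoTwoIdeal [IsGradedCommTwoRing.{w} C]
    (h0 : ∀ X Y : C, ¬ IsIso (0 : X ⟶ Y))
    (hC : ∀ a b : 𝟙_ C ⟶ 𝟙_ C, a + b = 𝟙 _ → IsIso a ∨ IsIso b) :
    (nonIsoTwoIdeal.{w} h0 hC).IsProper :=
  ⟨𝟙_ C, 𝟙_ C, 𝟙 _, fun h => h inferInstance⟩

lemma le_nonIsoTwoIdeal [IsGradedCommTwoRing.{w} C]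
    (h0 : ∀ X Y : C, ¬ IsIso (0 : X ⟶ Y))
    (hC : ∀ a b : 𝟙_ C ⟶ 𝟙_ C, a + b = 𝟙 _ → IsIso a ∨ IsIso b)
    {I : HomogeneousTwoIdeal C} (hI : I.IsProper) : I ≤ nonIsoTwoIdeal.{w} h0 hC := by
  obtain ⟨X', Y', f, hf⟩ := hI
  intro X Y r hr (_ : IsIso r)
  exact hf (I.mem_of_isIso.{w} r hr f)

lemma isMaximal_iff_eq_nonIsoTwoIdeal [IsGradedCommTwoRing.{w} C]
    (h0 : ∀ X Y : C, ¬ IsIso (0 : X ⟶ Y))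
    (hC : ∀ a b : 𝟙_ C ⟶ 𝟙_ C, a + b = 𝟙 _ → IsIso a ∨ IsIso b)
    (I : HomogeneousTwoIdeal C) : I.IsMaximal ↔ I = nonIsoTwoIdeal.{w} h0 hC := by
  constructor
  · intro hI
    exact hI.eq_of_le (isProper_nonIsoTwoIdeal h0 hC) (le_nonIsoTwoIdeal h0 hC hI.prop)
  · rintro rfl
    exact ⟨isProper_nonIsoTwoIdeal h0 hC, fun J hJ _ => le_nonIsoTwoIdeal h0 hC hJ⟩

end GradedTwoRing

/-! ### Thick ideals and cones of scalars. -/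

section TensorTriangulatedBasics

variable {T : Type u} [Category.{v} T] [HasZeroObject T] [HasShift T ℤ] [Preadditive T]
  [∀ n : ℤ, (shiftFunctor T n).Additive] [Pretriangulated T]
  [MonoidalCategory T]

namespace IsThickTensorIdeal

variable {J : ObjectProperty T}

lemma isClosedUnderIsomorphisms (hJ : IsThickTensorIdeal J) : J.IsClosedUnderIsomorphisms :=
  have := hJ.isStableUnderRetracts
  inferInstance

lemma mem_of_isZero (hJ : IsThickTensorIdeal J) {X : T} (hX : IsZero X) : J X :=
  have := hJ.isClosedUnderIsomorphisms
  have := hJ.isTriangulated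
  J.prop_of_isZero hX

lemma tensor_mem_left [SymmetricCategory T] (hJ : IsThickTensorIdeal J) (X Y : T) (hX : J X) : J (X ⊗ Y) :=
  have := hJ.isClosedUnderIsomorphisms
  J.prop_of_iso (β_ Y X) (hJ.tensor_mem Y X hX)

end IsThickTensorIdeal

variable [SymmetricCategory T] [TensorTriangulated T]

namespace TensorTriangulated

noncomputable instance (X : T) : (tensorLeft X).CommShift ℤ := commShift X

attribute [instance] isTriangulated commShift_natural

instance : MonoidalPreadditive T := by
  have h0 (X Y Z : T) : X ◁ (0 : Y ⟶ Z) = 0 := (tensorLeft X).map_zero Y Z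
  have h1 (X : T) {Y Z : T} (f g : Y ⟶ Z) : X ◁ (f + g) = X ◁ f + X ◁ g :=
    (tensorLeft X).map_add
  have h2 (X : T) {Y Z : T} (f : Y ⟶ Z) : f ▷ X = (β_ Y X).hom ≫ X ◁ f ≫ (β_ X Z).hom := by
    rw [← BraidedCategory.braiding_naturality_left_assoc, SymmetricCategory.symmetry, Category.comp_id]
  exact { whiskerLeft_zero := h0 _ _ _
          zero_whiskerRight := by intros; rw [h2, h0, zero_comp, comp_zero]
          whiskerLeft_add := h1 _
          add_whiskerRight := by intros; rw [h2, h1, Preadditive.add_comp, Preadditive.comp_add, ← h2, ← h2] }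

omit [SymmetricCategory T] in
-- This uses naturality of the shift isomorphisms in the first tensor factor. Their compatibility
-- with the unitors is not needed: the automorphism `e` may be nontrivial, but scalars commute with
-- it.
lemma scalar_shift (r : 𝟙_ T ⟶ 𝟙_ T) (X : T) :
    scalar r (X⟦(1 : ℤ)⟧) = (scalar r X)⟦(1 : ℤ)⟧' := by
  let e : X⟦(1 : ℤ)⟧ ≅ X⟦(1 : ℤ)⟧ :=
    (λ_ (X⟦(1 : ℤ)⟧)).symm ≪≫ ((tensorLeft (𝟙_ T)).commShiftIso (1 : ℤ)).app X ≪≫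
      (shiftFunctor T (1 : ℤ)).mapIso (λ_ X)
  have h : scalar r (X⟦(1 : ℤ)⟧) ≫ e.hom = e.hom ≫ (scalar r X)⟦(1 : ℤ)⟧' := by
    have := NatTrans.shift_app_comm ((curriedTensor T).map r) (1 : ℤ) X
    dsimp at this
    have h' : (λ_ X).hom⟦(1 : ℤ)⟧' ≫ (scalar r X)⟦(1 : ℤ)⟧' =
        (r ▷ X)⟦(1 : ℤ)⟧' ≫ (λ_ X).hom⟦(1 : ℤ)⟧' := by
      simp only [← Functor.map_comp, scalar, Iso.hom_inv_id_assoc]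
    simp only [e, Iso.trans_hom, Iso.symm_hom, Iso.app_hom, Functor.mapIso_hom,
      Category.assoc, h']
    simp only [scalar, Category.assoc, Iso.hom_inv_id_assoc]
    rw [← Category.assoc (r ▷ _), ← Category.assoc (((tensorLeft (𝟙_ T)).commShiftIso _).hom.app X)]
    exact congrArg (fun t => (λ_ (X⟦(1 : ℤ)⟧)).inv ≫ t ≫ (λ_ X).hom⟦(1 : ℤ)⟧') this.symm
  rw [scalar_naturality] at h
  exact (cancel_epi _).1 h

omit [SymmetricCategory T] in
/-- The square of an endomorphism of the unit annihilates its cone. -/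
lemma scalar_comp_scalar_eq_zero (r : 𝟙_ T ⟶ 𝟙_ T) {C : T} {q : 𝟙_ T ⟶ C}
    {w : C ⟶ (𝟙_ T)⟦(1 : ℤ)⟧} (h : Triangle.mk r q w ∈ distTriang T) :
    scalar r C ≫ scalar r C = 0 := by
  have hq : q ≫ scalar r C = 0 := by
    have : r ≫ q = 0 := comp_distTriang_mor_zero₁₂ _ h
    rw [← scalar_naturality, scalar_unit, this]
  have hw : w ≫ r⟦(1 : ℤ)⟧' = 0 := comp_distTriang_mor_zero₃₁ _ h
  obtain ⟨k, hk⟩ : ∃ k : (𝟙_ T)⟦(1 : ℤ)⟧ ⟶ C, scalar r C = w ≫ k :=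
    Triangle.yoneda_exact₃ _ h (scalar r C) hq
  -- The first factor is `w ≫ k`; the second moves past `k` and becomes `r⟦1⟧'`, which `w`
  -- annihilates.
  calc scalar r C ≫ scalar r C = w ≫ k ≫ scalar r C := by rw [hk, Category.assoc]
    _ = (w ≫ r⟦(1 : ℤ)⟧') ≫ k := by
      rw [← scalar_naturality, scalar_shift, scalar_unit, Category.assoc]
    _ = 0 := by rw [hw, zero_comp]

lemma isIso_scalar_iff (r : 𝟙_ T ⟶ 𝟙_ T) {C : T} {q : 𝟙_ T ⟶ C}
    {w : C ⟶ (𝟙_ T)⟦(1 : ℤ)⟧} (h : Triangle.mk r q w ∈ distTriang T) (X : T) :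
    IsIso (scalar r X) ↔ IsZero (X ⊗ C) := by
  have h' := (tensorLeft X).map_distinguished _ h
  have h1 : IsIso (X ◁ r) ↔ IsZero (X ⊗ C) := (Triangle.isZero₃_iff_isIso₁ _ h').symm
  rw [← h1]
  constructor
  · intro _
    have : X ◁ r = (ρ_ X).hom ≫ scalar r X ≫ (ρ_ X).inv := by simp [scalar_eq_whiskerLeft]
    rw [this]; infer_instance
  · intro _
    rw [scalar_eq_whiskerLeft]; infer_instance

/-- The cones of two endomorphisms of the unit that add up to the identity are orthogonal. -/
lemma isZero_tensor_of_add_eq_id {r s : 𝟙_ T ⟶ 𝟙_ T} (hrs : r + s = 𝟙 _) {C D : T}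
    {q : 𝟙_ T ⟶ C} {w : C ⟶ (𝟙_ T)⟦(1 : ℤ)⟧} (hC : Triangle.mk r q w ∈ distTriang T)
    {q' : 𝟙_ T ⟶ D} {w' : D ⟶ (𝟙_ T)⟦(1 : ℤ)⟧} (hD : Triangle.mk s q' w' ∈ distTriang T) :
    IsZero (D ⊗ C) := by
  rw [← isIso_scalar_iff r hC]
  have hs := scalar_comp_scalar_eq_zero s hD
  have h1 : scalar r D + scalar s D = 𝟙 D := by rw [← scalar_add, hrs, scalar_id]
  rw [← eq_sub_iff_add_eq] at h1
  rw [h1]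
  exact ⟨𝟙 D + scalar s D, by simp [hs], by simp [hs]⟩

end TensorTriangulated

namespace IsThickTensorIdeal

open TensorTriangulated

variable {J : ObjectProperty T}

variable (T) in
omit [SymmetricCategory T] in
lemma isZero : IsThickTensorIdeal (fun X : T => IsZero X) where
  isTriangulated :=
    { exists_zero := ⟨_, isZero_zero T, isZero_zero T⟩
      isStableUnderShiftBy := fun n => ⟨fun _ hX => (shiftFunctor T n).map_isZero hX⟩
      ext₂' := fun S hS h₁ h₃ => ObjectProperty.le_isoClosure _ _
        (Triangle.isZero₂_of_isZero₁₃ S hS h₁ h₃) }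
  isStableUnderRetracts := ⟨fun r h => IsZero.of_mono r.i h⟩
  tensor_mem X _ hY := (tensorLeft X).map_isZero hY

/-- The ideal quotient of a thick tensor ideal by an object. -/
lemma colon (hJ : IsThickTensorIdeal J) (Z : T) :
    IsThickTensorIdeal (J.inverseImage (tensorLeft Z)) where
  isTriangulated :=
    have := hJ.isClosedUnderIsomorphisms
    have := hJ.isTriangulated
    inferInstance
  isStableUnderRetracts :=
    have := hJ.isStableUnderRetracts
    ⟨fun r h => J.prop_of_retract (r.map (tensorLeft Z)) h⟩
  tensor_mem X Y hY :=
    have := hJ.isClosedUnderIsomorphisms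
    J.prop_of_iso ((α_ X Z Y).symm ≪≫ whiskerRightIso (β_ X Z) Y ≪≫ α_ Z X Y)
      (hJ.tensor_mem X _ hY)

/-- Modulo `J`, `r` is invertible on `C`, its cone there being `C ⊗ C`. But `r²` is zero on `C`, so
`0 : C ⟶ C` has a cone in `J`, and `C` is a retract of that cone. -/
lemma mem_of_tensor_self_mem [IsTriangulated T] (hJ : IsThickTensorIdeal J)
    (r : 𝟙_ T ⟶ 𝟙_ T) {C : T} {q : 𝟙_ T ⟶ C}
    {w : C ⟶ (𝟙_ T)⟦(1 : ℤ)⟧} (h : Triangle.mk r q w ∈ distTriang T) (hC : J (C ⊗ C)) : J C := by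
  have := hJ.isStableUnderRetracts
  have := hJ.isTriangulated
  have h1 : J.trW (C ◁ r) := ObjectProperty.trW.mk _ ((tensorLeft C).map_distinguished _ h) hC
  have h2 : J.trW (scalar r C) := by
    rw [scalar_eq_whiskerLeft]
    simpa only [MorphismProperty.cancel_left_of_respectsIso,
      MorphismProperty.cancel_right_of_respectsIso] using h1
  have h3 := J.trW.comp_mem _ _ h2 h2
  rw [scalar_comp_scalar_eq_zero r h] at h3
  obtain ⟨Z, g, k, hZ, hJZ⟩ := h3
  obtain ⟨p, hp⟩ := Triangle.yoneda_exact₂ _ hZ (𝟙 C) zero_comp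
  exact J.prop_of_retract ⟨g, p, hp.symm⟩ hJZ

end IsThickTensorIdeal

end TensorTriangulatedBasics

/-! ### Primes, closed points and locality. -/

section Spectrum

variable {T : Type u} [Category.{v} T] [HasZeroObject T] [HasShift T ℤ] [Preadditive T]
  [∀ n : ℤ, (shiftFunctor T n).Additive] [Pretriangulated T]
  [MonoidalCategory T]

namespace IsThickTensorIdeal

lemma iUnion_chain {c : Set (ObjectProperty T)} (hc : IsChain (· ≤ ·) c) (hne : c.Nonempty)
    (h : ∀ J ∈ c, IsThickTensorIdeal J) :
    IsThickTensorIdeal (fun X : T => ∃ J ∈ c, J X) where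
  isTriangulated :=
    { exists_zero := by
        obtain ⟨J, hJ⟩ := hne
        have := (h J hJ).isTriangulated
        obtain ⟨Z, hZ, hJZ⟩ := J.exists_prop_of_containsZero
        exact ⟨Z, hZ, J, hJ, hJZ⟩
      isStableUnderShiftBy := fun n => ⟨fun X ⟨J, hJ, hX⟩ =>
        have := (h J hJ).isTriangulated
        ⟨J, hJ, J.le_shift n X hX⟩⟩
      ext₂' := by
        rintro S hS ⟨J₁, hJ₁, h₁⟩ ⟨J₃, hJ₃, h₃⟩
        obtain ⟨J, hJ, hle₁, hle₃⟩ := hc.directedOn J₁ hJ₁ J₃ hJ₃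
        have := (h J hJ).isTriangulated
        have := (h J hJ).isClosedUnderIsomorphisms
        exact ObjectProperty.le_isoClosure _ _
          ⟨J, hJ, J.ext_of_isTriangulatedClosed₂ S hS (hle₁ _ h₁) (hle₃ _ h₃)⟩ }
  isStableUnderRetracts := ⟨fun r ⟨J, hJ, hX⟩ =>
    have := (h J hJ).isStableUnderRetracts
    ⟨J, hJ, J.prop_of_retract r hX⟩⟩
  tensor_mem X Y := fun ⟨J, hJ, hY⟩ => ⟨J, hJ, (h J hJ).tensor_mem X Y hY⟩

lemma iInter {c : Set (ObjectProperty T)} (h : ∀ J ∈ c, IsThickTensorIdeal J) :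
    IsThickTensorIdeal (fun X : T => ∀ J ∈ c, J X) where
  isTriangulated :=
    { exists_zero := ⟨_, isZero_zero T, fun J hJ =>
        have := (h J hJ).isClosedUnderIsomorphisms
        have := (h J hJ).isTriangulated
        J.prop_of_isZero (isZero_zero T)⟩
      isStableUnderShiftBy := fun n => ⟨fun X hX J hJ =>
        have := (h J hJ).isTriangulated
        J.le_shift n X (hX J hJ)⟩
      ext₂' := fun S hS h₁ h₃ => ObjectProperty.le_isoClosure _ _ fun J hJ =>
        have := (h J hJ).isTriangulated
        have := (h J hJ).isClosedUnderIsomorphisms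
        J.ext_of_isTriangulatedClosed₂ S hS (h₁ J hJ) (h₃ J hJ) }
  isStableUnderRetracts := ⟨fun r hX J hJ =>
    have := (h J hJ).isStableUnderRetracts
    J.prop_of_retract r (hX J hJ)⟩
  tensor_mem X Y hY J hJ := (h J hJ).tensor_mem X Y (hY J hJ)

end IsThickTensorIdeal

namespace TriangularSpectrum

lemma not_prime_unit (P : TriangularSpectrum T) : ¬ P.prime (𝟙_ T) := by
  obtain ⟨X, hX⟩ := P.proper
  have := P.isThickTensorIdeal.isClosedUnderIsomorphisms
  exact fun h => hX (P.prime.prop_of_iso (ρ_ X) (P.isThickTensorIdeal.tensor_mem X _ h))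

/-- Every prime contains a minimal one. -/
lemma exists_minimal_le (P : TriangularSpectrum T) :
    ∃ M : TriangularSpectrum T, M.prime ≤ P.prime ∧
      ∀ Q : TriangularSpectrum T, Q.prime ≤ M.prime → Q = M := by
  -- The order is reversed: the intersection of a chain of primes is prime.
  obtain ⟨m, hmP, hm⟩ := zorn_le_nonempty₀ (α := (ObjectProperty T)ᵒᵈ)
    {J | ∃ Q : TriangularSpectrum T, Q.prime = OrderDual.ofDual J} (fun c hcS hc J₀ hJ₀ => by
      have hth (J) (hJ : J ∈ OrderDual.ofDual '' c) : IsThickTensorIdeal J := by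
        obtain ⟨J, hJ, rfl⟩ := hJ
        obtain ⟨Q, hQ⟩ := hcS hJ
        exact hQ ▸ Q.isThickTensorIdeal
      refine ⟨OrderDual.toDual (fun X : T => ∀ J ∈ OrderDual.ofDual '' c, J X),
        ⟨⟨_, .iInter hth, ⟨𝟙_ T, fun h => ?_⟩, fun X Y hXY => ?_⟩, rfl⟩, fun J hJ X hX => ?_⟩
      · obtain ⟨Q, hQ⟩ := hcS hJ₀
        exact Q.not_prime_unit (hQ ▸ h _ ⟨J₀, hJ₀, rfl⟩)
      · by_contra! hcon
        obtain ⟨⟨_, ⟨J₁, hJ₁, rfl⟩, hX⟩, ⟨_, ⟨J₂, hJ₂, rfl⟩, hY⟩⟩ := hcon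
        obtain ⟨J, hJ, hle₁, hle₂⟩ := hc.directedOn J₁ hJ₁ J₂ hJ₂
        obtain ⟨Q, hQ⟩ := hcS hJ
        have h := Q.mem_or_mem X Y (hQ ▸ hXY _ ⟨J, hJ, rfl⟩)
        rw [hQ] at h
        exact h.elim (fun h => hX (hle₁ _ h)) (fun h => hY (hle₂ _ h))
      · exact hX _ ⟨J, hJ, rfl⟩) (OrderDual.toDual P.prime) ⟨P, rfl⟩
  obtain ⟨M, hM⟩ := hm.prop
  refine ⟨M, hM ▸ hmP, fun Q hQ => ?_⟩
  have h := hm.eq_of_le (y := OrderDual.toDual Q.prime) ⟨Q, rfl⟩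
    (show Q.prime ≤ OrderDual.ofDual m from hM ▸ hQ)
  have h' : Q.prime = M.prime := by rw [hM, h]; rfl
  cases Q; cases M; cases h'; rfl

/-- The minimal primes are closed points of the spectrum. -/
lemma isClosed_singleton_of_minimal {M : TriangularSpectrum T}
    (hM : ∀ Q : TriangularSpectrum T, Q.prime ≤ M.prime → Q = M) :
    IsClosed ({M} : Set (TriangularSpectrum T)) := by
  have h : ({M} : Set (TriangularSpectrum T))ᶜ =
      ⋃ (X : T) (_ : ¬ M.prime X), {P : TriangularSpectrum T | P.prime X} := by
    ext Q
    simp only [Set.mem_compl_iff, Set.mem_singleton_iff, Set.mem_iUnion, Set.mem_ofPred_eq,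
      exists_prop]
    constructor
    · intro hQ
      by_contra! hcon
      exact hQ (hM Q fun X hX => by_contra fun hX' => hcon X hX' hX)
    · rintro ⟨X, hX, hQ⟩ rfl
      exact hX hQ
  rw [← isOpen_compl_iff, h]
  exact isOpen_iUnion fun X => isOpen_iUnion fun _ =>
    TopologicalSpace.isOpen_generateFrom_of_mem ⟨X, rfl⟩

variable [SymmetricCategory T] [TensorTriangulated T]

/-- If `C` belongs to every thick tensor ideal containing `C ⊗ C` and is not zero, then some
prime does not contain `C`. -/
lemma exists_not_mem {C : T} (hC : ¬ IsZero C)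
    (h : ∀ J : ObjectProperty T, IsThickTensorIdeal J → J (C ⊗ C) → J C) :
    ∃ P : TriangularSpectrum T, ¬ P.prime C := by
  obtain ⟨J, -, hJ⟩ := zorn_le_nonempty₀
    {J : ObjectProperty T | IsThickTensorIdeal J ∧ ¬ J C} (fun c hcS hc J₀ hJ₀ =>
      ⟨_, ⟨.iUnion_chain hc ⟨J₀, hJ₀⟩ fun J hJ => (hcS hJ).1, fun ⟨J, hJ, hJC⟩ => (hcS hJ).2 hJC⟩,
        fun J hJ X hX => ⟨J, hJ, hX⟩⟩) _ ⟨.isZero T, hC⟩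
  have hth := hJ.prop.1
  -- The colon ideal of `J` by `Z` contains `J` and also `X ∉ J`, so by maximality it contains `C`.
  -- Applied twice, this gives `C ⊗ C ∈ J`.
  have key (Z X : T) (hX : ¬ J X) (hZX : J (Z ⊗ X)) : J (Z ⊗ C) := by
    by_contra hZC
    have hle : J ≤ J.inverseImage (tensorLeft Z) := fun Y hY => hth.tensor_mem Z Y hY
    exact hX (hJ.le_of_ge ⟨hth.colon Z, hZC⟩ hle X hZX)
  have := hth.isClosedUnderIsomorphisms
  refine ⟨⟨J, hth, ⟨C, hJ.prop.2⟩, fun X Y hXY => ?_⟩, hJ.prop.2⟩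
  by_contra! hcon
  have h1 : J (C ⊗ X) := J.prop_of_iso (β_ X C) (key X Y hcon.2 hXY)
  exact hJ.prop.2 (h _ hth (key C X hcon.1 h1))

end TriangularSpectrum

namespace IsLocalTensorTriangulated

/-- In a local tensor triangulated category, if the tensor product of two objects is zero then one
of them belongs to every prime. -/
lemma forall_mem_or_forall_mem (hT : IsLocalTensorTriangulated T) {X Y : T}
    (hXY : IsZero (X ⊗ Y)) :
    (∀ P : TriangularSpectrum T, P.prime X) ∨ (∀ P : TriangularSpectrum T, P.prime Y) := by
  obtain ⟨M, -, hM⟩ := hT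
  -- A minimal prime below `P` is a closed point, hence equals `M`.
  have hle (P : TriangularSpectrum T) : M.prime ≤ P.prime := by
    obtain ⟨N, hNP, hN⟩ := P.exists_minimal_le
    exact hM N (TriangularSpectrum.isClosed_singleton_of_minimal hN) ▸ hNP
  exact (M.mem_or_mem X Y (M.isThickTensorIdeal.mem_of_isZero hXY)).imp
    (fun h P => hle P X h) (fun h P => hle P Y h)

/-- Otherwise `𝟙` would lie in a prime; locality serves only to provide one. -/
lemma not_isZero_of_isTensorInvertible [SymmetricCategory T] (hT : IsLocalTensorTriangulated T) {X : T}
    (hX : IsTensorInvertible X) : ¬ IsZero X := by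
  obtain ⟨P, -⟩ := hT
  obtain ⟨Y, ⟨e⟩⟩ := hX
  have := P.isThickTensorIdeal.isClosedUnderIsomorphisms
  exact fun h => P.not_prime_unit (P.prime.prop_of_iso e
    (P.isThickTensorIdeal.tensor_mem_left X Y (P.isThickTensorIdeal.mem_of_isZero h)))

variable [SymmetricCategory T] [TensorTriangulated T]

/-- The ring of endomorphisms of the unit of a local tensor triangulated category is local. -/
lemma isIso_or_isIso_of_add_eq_id [IsTriangulated T] (hT : IsLocalTensorTriangulated T)
    {r s : 𝟙_ T ⟶ 𝟙_ T} (hrs : r + s = 𝟙 _) : IsIso r ∨ IsIso s := by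
  obtain ⟨C, q, w, hC⟩ := distinguished_cocone_triangle r
  obtain ⟨D, q', w', hD⟩ := distinguished_cocone_triangle s
  have key {t : 𝟙_ T ⟶ 𝟙_ T} {E : T} {p : 𝟙_ T ⟶ E} {k : E ⟶ (𝟙_ T)⟦(1 : ℤ)⟧}
      (hE : Triangle.mk t p k ∈ distTriang T) (h : ∀ P : TriangularSpectrum T, P.prime E) :
      IsIso t := by
    refine (Triangle.isZero₃_iff_isIso₁ _ hE).1 (by_contra fun h0 => ?_)
    obtain ⟨P, hP⟩ := TriangularSpectrum.exists_not_mem h0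
      fun J hJ => hJ.mem_of_tensor_self_mem t hE
    exact hP (h P)
  exact (hT.forall_mem_or_forall_mem
    (TensorTriangulated.isZero_tensor_of_add_eq_id hrs hC hD)).symm.imp (key hC) (key hD)

end IsLocalTensorTriangulated

/-- Inverses must be found inside `R`: the dual lies there and is an inverse. -/
lemma IsCentralTwoRing.isGradedCommTwoRing [SymmetricCategory T]
    [TensorTriangulated T] [EssentiallySmall.{w} T] (R : ObjectProperty T) [IsCentralTwoRing R] :
    IsGradedCommTwoRing.{w} R.FullSubcategory where
  essentiallySmall := essentiallySmall_of_fully_faithful R.ι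
  invertible X := by
    obtain ⟨Y, hY, ⟨_⟩⟩ := IsCentralTwoRing.dual_mem X.obj X.property
    obtain ⟨e⟩ := (IsCentralTwoRing.invertible X.obj X.property).nonempty_iso_of_exactPairing
      (Y := Y)
    exact ⟨⟨Y, hY⟩, ⟨R.isoMk e⟩⟩

end Spectrum

theorem mainTheorem6 (T : Type u) [Category.{v} T] [HasZeroObject T] [HasShift T ℤ]
    [Preadditive T] [∀ n : ℤ, (shiftFunctor T n).Additive] [Pretriangulated T]
    [IsTriangulated T] [MonoidalCategory T] [SymmetricCategory T] [TensorTriangulated T]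
    [EssentiallySmall.{w} T] (hT : IsLocalTensorTriangulated T)
    (R : ObjectProperty T) [IsCentralTwoRing R] :
    IsGradedCommTwoRing.{w} R.FullSubcategory ∧
      ∃ m : HomogeneousTwoIdeal R.FullSubcategory,
        m.IsMaximal ∧
        (∀ m' : HomogeneousTwoIdeal R.FullSubcategory, m'.IsMaximal → m' = m) ∧
        ∀ (g h : R.FullSubcategory) (r : g ⟶ h), r ∈ m.hom g h ↔ ¬ IsIso r := by
  have hR := IsCentralTwoRing.isGradedCommTwoRing.{w} R
  have h0 (X Y : R.FullSubcategory) : ¬ IsIso (0 : X ⟶ Y) := fun h =>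
    hT.not_isZero_of_isTensorInvertible (IsCentralTwoRing.invertible X.obj X.property) (by
      have : IsIso (0 : X.obj ⟶ Y.obj) := inferInstanceAs (IsIso (R.ι.map (0 : X ⟶ Y)))
      exact IsZero.of_mono_zero X.obj Y.obj)
  have hC (a b : 𝟙_ R.FullSubcategory ⟶ 𝟙_ R.FullSubcategory) (hab : a + b = 𝟙 _) :
      IsIso a ∨ IsIso b := by
    have h : R.ι.map a + R.ι.map b = 𝟙 (𝟙_ T) := by
      rw [← Functor.map_add, hab]; rfl
    exact (hT.isIso_or_isIso_of_add_eq_id h).imp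
      (fun (_ : IsIso (R.ι.map a)) => isIso_of_reflects_iso a R.ι)
      (fun (_ : IsIso (R.ι.map b)) => isIso_of_reflects_iso b R.ι)
  exact ⟨hR, nonIsoTwoIdeal.{w} h0 hC, (isMaximal_iff_eq_nonIsoTwoIdeal h0 hC _).2 rfl,
    fun m' hm' => (isMaximal_iff_eq_nonIsoTwoIdeal h0 hC m').1 hm',
    fun _ _ r => mem_nonIsoTwoIdeal h0 hC r⟩
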